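/- Fix an arbitrary set $\mathbf{Prop}$ of propositional letters. Formulas are given by $\varphi ::= \bot \mid p \mid \neg\varphi \mid \varphi\lor\varphi \mid \langle\cdot\rangle\varphi\varphi$ with $p\in\mathbf{Prop}$, where $\langle\cdot\rangle$ is a binary modality. A poset model $(P,\le,V)$ is a partially ordered set $(P,\le)$ with a valuation $V:\mathbf{Prop}\to\mathcal P(P)$. There are two satisfaction relations on points of poset models, $\Vdash_M$ and $\Vdash_S$. Both treat letters and Boolean connectives in the usual way, and they differ only in the modality: - $s\Vdash_M\langle\cdot\rangle\varphi\psi$ iff there are $t,u\in P$ with $t\Vdash_M\varphi$, $u\Vdash_M\psi$, and $s$ is a minimal upper bound of $\{t,u\}$ (that is, $t,u\le s$, and no upper bound $x$ of $\{t,u\}$ satisfies $x<s$); - $s\Vdash_S\langle\cdot\rangle\varphi\psi$ iff there are $t,u\in P$ with $t\Vdash_S\varphi$, $u\Vdash_S\psi$, and $s$ is the least upper bound of $\{t,u\}$. Let $\mathbf{MIN}$ (respectively $\mathbf{MIL}$) be the set of formulas true at every point of every poset model under $\Vdash_M$ (respectively $\Vdash_S$). **Theorem.** $\mathbf{MIN}=\mathbf{MIL}$.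 The consequence relations coincide as well: for every (possibly infinite) set $\Gamma$ of formulas and every formula $\varphi$, the following are equivalent: 1. for every poset model and every point $s$ of it, if $s\Vdash_M\gamma$ for all $\gamma\in\Gamma$, then $s\Vdash_M\varphi$; 2. for every poset model and every point $s$ of it, if $s\Vdash_S\gamma$ for all $\gamma\in\Gamma$, then $s\Vdash_S\varphi$. -/

import Mathlib

universe u v

/-- Formulas over a set `Atom` of propositional letters:
falsum, letters, negation, disjunction, and one binary modality `fuse`. -/
inductive Formula (Atom : Type u) : Type u
  | bot : Formula Atom
  | atom : Atom → Formula Atom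
  | neg : Formula Atom → Formula Atom
  | disj : Formula Atom → Formula Atom → Formula Atom
  | fuse : Formula Atom → Formula Atom → Formula Atom

/-- `s` is a minimal upper bound of `{t, u}`. -/
def IsMub {P : Type v} [PartialOrder P] (s t u : P) : Prop :=
  Minimal (fun x => x ∈ upperBounds ({t, u} : Set P)) s

/-- `s` is the least upper bound (supremum) of `{t, u}`. -/
def IsSup {P : Type v} [PartialOrder P] (s t u : P) : Prop :=
  IsLUB ({t, u} : Set P) s

/-- Satisfaction at a point of the poset model `(P, ≤, V)`, the modality being read by
minimal upper bounds. -/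
def SatMub {Atom : Type u} {P : Type v} [PartialOrder P] (V : Atom → Set P) :
    P → Formula Atom → Prop
  | _, .bot => False
  | s, .atom p => s ∈ V p
  | s, .neg φ => ¬ SatMub V s φ
  | s, .disj φ ψ => SatMub V s φ ∨ SatMub V s ψ
  | s, .fuse φ ψ => ∃ t u : P, SatMub V t φ ∧ SatMub V u ψ ∧ IsMub s t u

/-- Satisfaction at a point of the poset model `(P, ≤, V)`, the modality being read by
least upper bounds. -/
def SatSup {Atom : Type u} {P : Type v} [PartialOrder P] (V : Atom → Set P) :
    P → Formula Atom → Prop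
  | _, .bot => False
  | s, .atom p => s ∈ V p
  | s, .neg φ => ¬ SatSup V s φ
  | s, .disj φ ψ => SatSup V s φ ∨ SatSup V s ψ
  | s, .fuse φ ψ => ∃ t u : P, SatSup V t φ ∧ SatSup V u ψ ∧ IsSup s t u

/-- Validity in the poset frame `P` under the minimal-upper-bound reading. -/
def FrameValidMub {Atom : Type u} (P : Type v) [PartialOrder P] (φ : Formula Atom) : Prop :=
  ∀ (V : Atom → Set P) (s : P), SatMub V s φ

/-- Validity in the poset frame `P` under the least-upper-bound reading. -/
def FrameValidSup {Atom : Type u} (P : Type v) [PartialOrder P] (φ : Formula Atom) : Prop :=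
  ∀ (V : Atom → Set P) (s : P), SatSup V s φ

/-- The modal logic of minimal upper bounds, as the set of formulas valid in all posets. -/
def MIN (Atom : Type u) : Set (Formula Atom) :=
  {φ | ∀ (P : Type v) [PartialOrder P], FrameValidMub P φ}

/-- Modal information logic, as the set of formulas valid in all posets. -/
def MIL (Atom : Type u) : Set (Formula Atom) :=
  {φ | ∀ (P : Type v) [PartialOrder P], FrameValidSup P φ}

/-- The (local) consequence relation over all posets under the minimal-upper-bound reading. -/
def ConsequenceMIN (Atom : Type u) (Γ : Set (Formula Atom)) (φ : Formula Atom) : Prop :=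
  ∀ (P : Type v) [PartialOrder P] (V : Atom → Set P) (s : P),
    (∀ γ ∈ Γ, SatMub V s γ) → SatMub V s φ

/-- The (local) consequence relation over all posets under the least-upper-bound reading. -/
def ConsequenceMIL (Atom : Type u) (Γ : Set (Formula Atom)) (φ : Formula Atom) : Prop :=
  ∀ (P : Type v) [PartialOrder P] (V : Atom → Set P) (s : P),
    (∀ γ ∈ Γ, SatSup V s γ) → SatSup V s φ

/-! Each pointed model for one reading is matched, along bounded morphisms, by one for the other
reading with the same theory, so infinite `Γ` costs nothing. The core is a cover, `Weighting C`, of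
a poset with a relation `C` satisfying `IsSeparatedSup`. Triples in `C` lift to suprema, while every
minimal upper bound projects into `C`: outside `C`, a separating set supplies an integer weight that
can be lowered, so no upper bound is minimal. Hence the cover represents `C` under both readings.
For a supremum model take `C = IsSup`. `IsMub` need not consist of suprema, so a minimal-upper-bound
model is first unravelled into a tree, where siblings have their parent as supremum and `Splits`
serves as `C`. -/

/-- Satisfaction in a Kripke model whose binary modality is interpreted by the ternary
relation `R`. -/
def SatRel {Atom : Type u} {W : Type v} (R : W → W → W → Prop) (V : Atom → Set W) :
    W → Formula Atom → Prop
  | _, .bot => False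
  | s, .atom p => s ∈ V p
  | s, .neg φ => ¬ SatRel R V s φ
  | s, .disj φ ψ => SatRel R V s φ ∨ SatRel R V s ψ
  | s, .fuse φ ψ => ∃ t u : W, SatRel R V t φ ∧ SatRel R V u ψ ∧ R s t u

theorem satMub_iff_satRel {Atom : Type u} {P : Type v} [PartialOrder P] (V : Atom → Set P)
    (φ : Formula Atom) (s : P) : SatMub V s φ ↔ SatRel IsMub V s φ := by
  induction φ generalizing s with
  | bot => simp [SatMub, SatRel]
  | atom p => simp [SatMub, SatRel]
  | neg φ ih => simp [SatMub, SatRel, ih]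
  | disj φ ψ ih₁ ih₂ => simp [SatMub, SatRel, ih₁, ih₂]
  | fuse φ ψ ih₁ ih₂ => simp [SatMub, SatRel, ih₁, ih₂]

theorem satSup_iff_satRel {Atom : Type u} {P : Type v} [PartialOrder P] (V : Atom → Set P)
    (φ : Formula Atom) (s : P) : SatSup V s φ ↔ SatRel IsSup V s φ := by
  induction φ generalizing s with
  | bot => simp [SatSup, SatRel]
  | atom p => simp [SatSup, SatRel]
  | neg φ ih => simp [SatSup, SatRel, ih]
  | disj φ ψ ih₁ ih₂ => simp [SatSup, SatRel, ih₁, ih₂]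
  | fuse φ ψ ih₁ ih₂ => simp [SatSup, SatRel, ih₁, ih₂]

/-- Bounded morphisms between frames with a ternary relation. -/
structure IsBoundedMorphism {W W' : Type v} (R : W → W → W → Prop) (R' : W' → W' → W' → Prop)
    (f : W → W') : Prop where
  forth : ∀ s t u, R s t u → R' (f s) (f t) (f u)
  back : ∀ s t' u', R' (f s) t' u' → ∃ t u, f t = t' ∧ f u = u' ∧ R s t u

theorem IsBoundedMorphism.satRel_iff {Atom : Type u} {W W' : Type v} {R : W → W → W → Prop}
    {R' : W' → W' → W' → Prop} {f : W → W'} (hf : IsBoundedMorphism R R' f)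
    (V : Atom → Set W') (φ : Formula Atom) (s : W) :
    SatRel R (fun p => f ⁻¹' V p) s φ ↔ SatRel R' V (f s) φ := by
  induction φ generalizing s with
  | bot => simp [SatRel]
  | atom p => simp [SatRel]
  | neg φ ih => simp [SatRel, ih]
  | disj φ ψ ih₁ ih₂ => simp [SatRel, ih₁, ih₂]
  | fuse φ ψ ih₁ ih₂ =>
    simp only [SatRel, ih₁, ih₂]
    constructor
    · rintro ⟨t, u, ht, hu, h⟩
      exact ⟨f t, f u, ht, hu, hf.forth _ _ _ h⟩
    · rintro ⟨t', u', ht, hu, h⟩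
      obtain ⟨t, u, rfl, rfl, htu⟩ := hf.back _ _ _ h
      exact ⟨t, u, ht, hu, htu⟩

/-! ### Separated relations and their weighted covers -/

section PartialOrder

variable {P : Type v} [PartialOrder P]

theorem isMub_iff {s t u : P} :
    IsMub s t u ↔ t ≤ s ∧ u ≤ s ∧ ∀ x, t ≤ x → u ≤ x → x ≤ s → s ≤ x := by
  simp only [IsMub, Minimal, mem_upperBounds, Set.mem_insert_iff, Set.mem_singleton_iff,
    forall_eq_or_imp, forall_eq]
  tauto

theorem isSup_iff {s t u : P} :
    IsSup s t u ↔ t ≤ s ∧ u ≤ s ∧ ∀ x, t ≤ x → u ≤ x → s ≤ x := by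
  simp only [IsSup, IsLUB, IsLeast, lowerBounds, mem_upperBounds, Set.mem_insert_iff,
    Set.mem_singleton_iff, forall_eq_or_imp, forall_eq, Set.mem_ofPred_eq]
  tauto

theorem IsSup.isMub {s t u : P} (h : IsSup s t u) : IsMub s t u := by
  rw [isSup_iff] at h
  exact isMub_iff.2 ⟨h.1, h.2.1, fun x h₁ h₂ _ => h.2.2 x h₁ h₂⟩

theorem IsMub.symm {s t u : P} (h : IsMub s t u) : IsMub s u t := by
  rw [isMub_iff] at h ⊢
  exact ⟨h.2.1, h.1, fun x h₁ h₂ => h.2.2 x h₂ h₁⟩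

theorem isMub_self_left {s t : P} (h : t ≤ s) : IsMub s s t :=
  isMub_iff.2 ⟨le_rfl, h, fun _ h₁ _ _ => h₁⟩

/-- A lower set is closed under `C` if it contains `s` whenever `C s t u` and it contains
`t` and `u`. -/
def IsClosedLowerSet (C : P → P → P → Prop) (D : Set P) : Prop :=
  IsLowerSet D ∧ ∀ s t u, C s t u → t ∈ D → u ∈ D → s ∈ D

/-- `C` consists of suprema, and closed lower sets separate `s` from `t, u` unless `C s t u`. -/
structure IsSeparatedSup (C : P → P → P → Prop) : Prop where
  isSup : ∀ s t u, C s t u → IsSup s t u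
  separated : ∀ s t u, t ≤ s → u ≤ s → ¬ C s t u →
    ∃ D, IsClosedLowerSet C D ∧ t ∈ D ∧ u ∈ D ∧ s ∉ D

/-- A point of `P` together with an integer weight for each closed lower set that omits it. -/
@[ext]
structure Weighting (C : P → P → P → Prop) where
  base : P
  weight : {D : Set P // IsClosedLowerSet C D} → WithBot ℤ
  weight_eq_bot : ∀ D, weight D = ⊥ ↔ base ∈ D.1

namespace Weighting

variable {C : P → P → P → Prop}

noncomputable instance : PartialOrder (Weighting C) :=
  PartialOrder.lift (fun q => (q.base, q.weight)) fun _ _ h =>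
    Weighting.ext (congrArg Prod.fst h) (congrArg Prod.snd h)

theorem le_iff {q r : Weighting C} : q ≤ r ↔ q.base ≤ r.base ∧ ∀ D, q.weight D ≤ r.weight D :=
  Iff.rfl

open Classical in
/-- Move the base point down, keeping the weights of the sets that omit the new base point. -/
noncomputable def restrict (q : Weighting C) (t : P) (ht : t ≤ q.base) : Weighting C where
  base := t
  weight D := if t ∈ D.1 then ⊥ else q.weight D
  weight_eq_bot D := by
    by_cases h : t ∈ D.1
    · simp [h]
    · simpa [h, q.weight_eq_bot] using fun h' => h (D.2.1 ht h')

theorem restrict_le (q : Weighting C) (t : P) (ht : t ≤ q.base) : q.restrict t ht ≤ q := by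
  refine le_iff.2 ⟨ht, fun D => ?_⟩
  by_cases h : t ∈ D.1 <;> simp [restrict, h]

/-- If `D` omits `q.base`, closure under `C` makes it omit `t` or `u`, and the corresponding
restriction retains the weight of `q` at `D`. -/
theorem isSup_restrict (hC : IsSeparatedSup C) (q : Weighting C) {t u : P}
    (h : C q.base t u) (ht : t ≤ q.base) (hu : u ≤ q.base) :
    IsSup q (q.restrict t ht) (q.restrict u hu) := by
  refine isSup_iff.2 ⟨restrict_le _ _ _, restrict_le _ _ _, fun r htr hur => ?_⟩
  rw [le_iff] at htr hur ⊢
  refine ⟨(isSup_iff.1 (hC.isSup _ _ _ h)).2.2 _ htr.1 hur.1, fun D => ?_⟩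
  by_cases htD : t ∈ D.1
  · by_cases huD : u ∈ D.1
    · rw [(q.weight_eq_bot D).2 (D.2.2 _ _ _ h htD huD)]
      exact bot_le
    · simpa [restrict, huD] using hur.2 D
  · simpa [restrict, htD] using htr.2 D

open Classical in
/-- Lower by one the weight of a set that omits the base point. -/
noncomputable def lower (q : Weighting C) (D : {D : Set P // IsClosedLowerSet C D}) :
    Weighting C where
  base := q.base
  weight := Function.update q.weight D ((q.weight D).map (· - 1))
  weight_eq_bot E := by
    by_cases h : E = D
    · subst h
      simp [q.weight_eq_bot]
    · simp [h, q.weight_eq_bot]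

theorem lower_lt (q : Weighting C) (D : {D : Set P // IsClosedLowerSet C D})
    (hD : q.base ∉ D.1) : q.lower D < q := by
  obtain ⟨n, hn⟩ := WithBot.ne_bot_iff_exists.1 (mt (q.weight_eq_bot D).1 hD)
  have hlt : (q.lower D).weight D < q.weight D := by
    simp [lower, ← hn]
  refine lt_of_le_not_ge (le_iff.2 ⟨le_rfl, fun E => ?_⟩) fun h => (h.2 D).not_gt hlt
  by_cases h : E = D
  · subst h
    exact hlt.le
  · simp [lower, h]

/-- The weight of `r` at `D` is `⊥`, so lowering that of `q` there cannot violate the bound. -/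
theorem le_lower {q r : Weighting C} (h : r ≤ q) (D : {D : Set P // IsClosedLowerSet C D})
    (hD : r.base ∈ D.1) : r ≤ q.lower D := by
  refine le_iff.2 ⟨h.1, fun E => ?_⟩
  by_cases hE : E = D
  · subst hE
    rw [(r.weight_eq_bot E).2 hD]
    exact bot_le
  · simpa [lower, hE] using h.2 E

theorem base_of_isMub (hC : IsSeparatedSup C) {q r r' : Weighting C} (h : IsMub q r r') :
    C q.base r.base r'.base := by
  obtain ⟨h₁, h₂, h₃⟩ := isMub_iff.1 h
  by_contra hn
  obtain ⟨D, hD, ht, hu, hs⟩ := hC.separated _ _ _ h₁.1 h₂.1 hn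
  -- Lowering the weight at the separating set gives a strictly smaller upper bound.
  have hlt := q.lower_lt ⟨D, hD⟩ hs
  exact hlt.not_ge (h₃ _ (le_lower h₁ ⟨D, hD⟩ ht) (le_lower h₂ ⟨D, hD⟩ hu) hlt.le)

theorem exists_isSup (hC : IsSeparatedSup C) (q : Weighting C) (t u : P)
    (h : C q.base t u) : ∃ r r' : Weighting C, r.base = t ∧ r'.base = u ∧ IsSup q r r' := by
  have hs := isSup_iff.1 (hC.isSup _ _ _ h)
  exact ⟨_, _, rfl, rfl, isSup_restrict hC q h hs.1 hs.2.1⟩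

theorem isBoundedMorphism_isMub (hC : IsSeparatedSup C) :
    IsBoundedMorphism IsMub C (base : Weighting C → P) where
  forth _ _ _ h := base_of_isMub hC h
  back q t u h := by
    obtain ⟨r, r', hr, hr', h⟩ := exists_isSup hC q t u h
    exact ⟨r, r', hr, hr', h.isMub⟩

theorem isBoundedMorphism_isSup (hC : IsSeparatedSup C) :
    IsBoundedMorphism IsSup C (base : Weighting C → P) where
  forth _ _ _ h := base_of_isMub hC h.isMub
  back := exists_isSup hC

theorem base_surjective : Function.Surjective (base : Weighting C → P) := by
  classical
  intro s
  exact ⟨⟨s, fun D => if s ∈ D.1 then ⊥ else 0, fun D => by by_cases h : s ∈ D.1 <;> simp [h]⟩,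
    rfl⟩

end Weighting

theorem isSeparatedSup_isSup : IsSeparatedSup (IsSup : P → P → P → Prop) where
  isSup _ _ _ h := h
  separated s t u ht hu h := by
    have : ∃ x, t ≤ x ∧ u ≤ x ∧ ¬ s ≤ x := by
      by_contra! hn
      exact h (isSup_iff.2 ⟨ht, hu, hn⟩)
    obtain ⟨x, htx, hux, hsx⟩ := this
    exact ⟨Set.Iic x, ⟨isLowerSet_Iic x, fun _ _ _ h h₁ h₂ => (isSup_iff.1 h).2.2 x h₁ h₂⟩,
      htx, hux, hsx⟩

end PartialOrder

/-! ### Unravelling into a tree -/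

/-- Finite sequences of choices of one component of a pair, the latest choice first. They
form a tree that grows downwards. -/
@[ext]
structure Unravelling (P : Type v) where
  path : List (P × P × Bool)

namespace Unravelling

variable {P : Type v}

instance : PartialOrder (Unravelling P) where
  le x y := y.path <:+ x.path
  le_refl x := List.suffix_refl _
  le_trans _ _ _ h₁ h₂ := h₂.trans h₁
  le_antisymm x y h₁ h₂ := Unravelling.ext (h₂.eq_of_length (le_antisymm h₂.length_le h₁.length_le))

theorem le_iff {x y : Unravelling P} : x ≤ y ↔ y.path <:+ x.path := Iff.rfl

/-- The node below `x` reached by choosing a component of `(t, u)`. -/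
def child (x : Unravelling P) (t u : P) (i : Bool) : Unravelling P := ⟨(t, u, i) :: x.path⟩

theorem child_le (x : Unravelling P) (t u : P) (i : Bool) : x.child t u i ≤ x :=
  List.suffix_cons _ _

theorem child_le_iff {x y : Unravelling P} {t u : P} {i : Bool} :
    x.child t u i ≤ y ↔ y = x.child t u i ∨ x ≤ y := by
  simp [le_iff, child, List.suffix_cons_iff, Unravelling.ext_iff]

theorem not_le_child (x : Unravelling P) (t u : P) (i : Bool) : ¬ x ≤ x.child t u i := by
  intro h
  have := List.IsSuffix.length_le h
  simp [child] at this

theorem child_not_le_child {x : Unravelling P} {t u : P} {i j : Bool} (hij : i ≠ j) :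
    ¬ x.child t u i ≤ x.child t u j := by
  rw [child_le_iff, not_or]
  exact ⟨by simpa [child] using hij.symm, not_le_child _ _ _ _⟩

variable [PartialOrder P]

open Classical in
/-- The label of a path starting at `s`: choices from `(t, u)` are only followed where the
current label is a minimal upper bound of `t` and `u`. -/
noncomputable def pathLabel (s : P) : List (P × P × Bool) → P
  | [] => s
  | (t, u, i) :: l => if IsMub (pathLabel s l) t u then (if i then t else u) else pathLabel s l

/-- The label of a node, for the tree with root label `s`. -/
noncomputable def label (s : P) (x : Unravelling P) : P := pathLabel s x.path

theorem label_child {s t u : P} {x : Unravelling P} (h : IsMub (label s x) t u) (i : Bool) :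
    label s (x.child t u i) = if i then t else u := by
  simp only [label, child, pathLabel] at h ⊢
  rw [if_pos h]

theorem pathLabel_append_le (s : P) (l l' : List (P × P × Bool)) :
    pathLabel s (l' ++ l) ≤ pathLabel s l := by
  induction l' with
  | nil => exact le_rfl
  | cons a l' ih =>
    obtain ⟨t, u, i⟩ := a
    refine le_trans ?_ ih
    simp only [List.cons_append, pathLabel]
    split_ifs with h hi
    · exact (isMub_iff.1 h).1
    · exact (isMub_iff.1 h).2.1
    -- An inadmissible choice leaves the label unchanged, so every list may serve as a node.
    · exact le_rfl

theorem label_mono (s : P) : Monotone (label s) := by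
  intro x y h
  obtain ⟨l, hl⟩ := le_iff.1 h
  simpa [label, ← hl] using pathLabel_append_le s y.path l

/-- `x` and `y` are the two children of `q` for one pair of which the label of `q` is a minimal
upper bound. -/
def AreSiblings (s : P) (q x y : Unravelling P) : Prop :=
  ∃ t u i, IsMub (label s q) t u ∧ x = q.child t u i ∧ y = q.child t u (!i)

/-- `q` splits into `x` and `y` if they are siblings below `q`, or if one of them is `q` and
the other lies below it. -/
def Splits (s : P) (q x y : Unravelling P) : Prop :=
  (x = q ∧ y ≤ q) ∨ (y = q ∧ x ≤ q) ∨ AreSiblings s q x y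

theorem isBoundedMorphism_label (s : P) : IsBoundedMorphism (Splits s) IsMub (label s) where
  forth q x y h := by
    rcases h with ⟨rfl, h⟩ | ⟨rfl, h⟩ | ⟨t, u, i, h, rfl, rfl⟩
    · exact isMub_self_left (label_mono s h)
    · exact (isMub_self_left (label_mono s h)).symm
    · rw [label_child h, label_child h]
      cases i
      · simpa using h.symm
      · simpa using h
  back q t u h :=
    ⟨q.child t u true, q.child t u false, by simp [label_child h], by simp [label_child h],
      .inr (.inr ⟨t, u, true, h, rfl, rfl⟩)⟩

/-- A child lies below a node only if it equals that node or its parent lies below it. So siblings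
can lie in the union without their parent only by being `x` and `y` themselves. -/
theorem isClosedLowerSet_Iic_union_Iic (s : P) {x y : Unravelling P}
    (h : ∀ q, ¬ AreSiblings s q x y) :
    IsClosedLowerSet (Splits s) (Set.Iic x ∪ Set.Iic y) := by
  refine ⟨(isLowerSet_Iic x).union (isLowerSet_Iic y), ?_⟩
  rintro r a b (⟨rfl, -⟩ | ⟨rfl, -⟩ | ⟨t, u, i, hr, rfl, rfl⟩) ha hb
  · exact ha
  · exact hb
  · by_contra hn
    simp only [Set.mem_union, Set.mem_Iic, child_le_iff, not_or] at ha hb hn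
    have hi : r.child t u i ≠ r.child t u (!i) := fun h =>
      child_not_le_child (by cases i <;> simp) h.le
    rcases ha with (ha | ha) | (ha | ha)
    · rcases hb with (hb | hb) | (hb | hb)
      · exact hi (ha.symm.trans hb)
      · exact hn.1 hb
      · exact h r ⟨t, u, i, hr, ha, hb⟩
      · exact hn.2 hb
    · exact hn.1 ha
    · rcases hb with (hb | hb) | (hb | hb)
      · exact h r ⟨t, u, !i, hr, hb, by simpa using ha⟩
      · exact hn.1 hb
      · exact hi (ha.symm.trans hb)
      · exact hn.2 hb
    · exact hn.2 ha

theorem AreSiblings.ne {s : P} {q x y : Unravelling P} (h : AreSiblings s q x y) : x ≠ y := by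
  obtain ⟨t, u, i, -, rfl, rfl⟩ := h
  exact fun h => child_not_le_child (by cases i <;> simp) h.le

theorem AreSiblings.isSup {s : P} {q x y : Unravelling P} (h : AreSiblings s q x y) :
    IsSup q x y := by
  have hne := h.ne
  obtain ⟨t, u, i, -, rfl, rfl⟩ := h
  refine isSup_iff.2 ⟨child_le _ _ _ _, child_le _ _ _ _, fun z hx hy => ?_⟩
  rcases child_le_iff.1 hx with rfl | hx
  · rcases child_le_iff.1 hy with hy | hy
    · exact absurd hy hne
    · exact hy
  · exact hx

theorem isClosedLowerSet_Iic (s : P) (x : Unravelling P) :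
    IsClosedLowerSet (Splits s) (Set.Iic x) := by
  simpa using isClosedLowerSet_Iic_union_Iic s (x := x) (y := x) fun _ h => h.ne rfl

theorem isSeparatedSup_splits (s : P) : IsSeparatedSup (Splits s) where
  isSup q x y h := by
    rcases h with ⟨rfl, h⟩ | ⟨rfl, h⟩ | h
    · exact isSup_iff.2 ⟨le_rfl, h, fun _ hx _ => hx⟩
    · exact isSup_iff.2 ⟨h, le_rfl, fun _ _ hy => hy⟩
    · exact AreSiblings.isSup h
  separated q x y hx hy h := by
    by_cases hs : ∃ r, AreSiblings s r x y
    · obtain ⟨r, hr⟩ := hs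
      have hsup := isSup_iff.1 hr.isSup
      -- An upper bound of siblings lies above their parent `r`, so `Set.Iic r` omits it unless it
      -- is `r`.
      refine ⟨_, isClosedLowerSet_Iic s r, hsup.1, hsup.2.1, fun hqr => h ?_⟩
      obtain rfl : q = r := le_antisymm hqr (hsup.2.2 q hx hy)
      exact .inr (.inr hr)
    · refine ⟨_, isClosedLowerSet_Iic_union_Iic s (not_exists.1 hs),
        .inl (Set.mem_Iic.2 le_rfl), .inr (Set.mem_Iic.2 le_rfl), ?_⟩
      rintro (hq | hq)
      · exact h (.inl ⟨le_antisymm hx hq, hy⟩)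
      · exact h (.inr (.inl ⟨le_antisymm hy hq, hx⟩))

end Unravelling

/-! ### Transfer between the two readings -/

theorem exists_satMub_iff_satSup {Atom : Type u} {P : Type v} [PartialOrder P]
    (V : Atom → Set P) (s : P) :
    ∃ (Q : Type v) (_ : PartialOrder Q) (W : Atom → Set Q) (q : Q),
      ∀ φ, SatMub W q φ ↔ SatSup V s φ := by
  obtain ⟨q, rfl⟩ := Weighting.base_surjective (C := IsSup) s
  refine ⟨Weighting (IsSup : P → P → P → Prop), inferInstance,
    fun p => Weighting.base ⁻¹' V p, q, fun φ => ?_⟩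
  rw [satMub_iff_satRel, satSup_iff_satRel]
  exact (Weighting.isBoundedMorphism_isMub isSeparatedSup_isSup).satRel_iff V φ q

theorem exists_satSup_iff_satMub {Atom : Type u} {P : Type v} [PartialOrder P]
    (V : Atom → Set P) (s : P) :
    ∃ (Q : Type v) (_ : PartialOrder Q) (W : Atom → Set Q) (q : Q),
      ∀ φ, SatSup W q φ ↔ SatMub V s φ := by
  obtain ⟨q, hq⟩ := Weighting.base_surjective (C := Unravelling.Splits s) ⟨[]⟩
  refine ⟨Weighting (Unravelling.Splits s), inferInstance,
    fun p => Weighting.base ⁻¹' (Unravelling.label s ⁻¹' V p), q, fun φ => ?_⟩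
  rw [satMub_iff_satRel, satSup_iff_satRel]
  refine ((Weighting.isBoundedMorphism_isSup (Unravelling.isSeparatedSup_splits s)).satRel_iff
    _ φ q).trans ?_
  rw [hq]
  exact (Unravelling.isBoundedMorphism_label s).satRel_iff V φ ⟨[]⟩

theorem consequenceMIN_iff_consequenceMIL {Atom : Type u} (Γ : Set (Formula Atom))
    (φ : Formula Atom) : ConsequenceMIN.{u, v} Atom Γ φ ↔ ConsequenceMIL.{u, v} Atom Γ φ := by
  constructor
  · intro h P _ V s hs
    obtain ⟨Q, _, W, q, hq⟩ := exists_satMub_iff_satSup V s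
    exact (hq φ).1 (h Q W q fun γ hγ => (hq γ).2 (hs γ hγ))
  · intro h P _ V s hs
    obtain ⟨Q, _, W, q, hq⟩ := exists_satSup_iff_satMub V s
    exact (hq φ).1 (h Q W q fun γ hγ => (hq γ).2 (hs γ hγ))

theorem mem_MIN_iff {Atom : Type u} (φ : Formula Atom) :
    φ ∈ MIN.{u, v} Atom ↔ ConsequenceMIN.{u, v} Atom ∅ φ := by
  simp [MIN, ConsequenceMIN, FrameValidMub]

theorem mem_MIL_iff {Atom : Type u} (φ : Formula Atom) :
    φ ∈ MIL.{u, v} Atom ↔ ConsequenceMIL.{u, v} Atom ∅ φ := by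
  simp [MIL, ConsequenceMIL, FrameValidSup]

theorem theorem3 (Atom : Type u) :
    MIN.{u, v} Atom = MIL.{u, v} Atom ∧
      ∀ (Γ : Set (Formula Atom)) (φ : Formula Atom),
        ConsequenceMIN.{u, v} Atom Γ φ ↔ ConsequenceMIL.{u, v} Atom Γ φ := by
  refine ⟨Set.ext fun φ => ?_, consequenceMIN_iff_consequenceMIL⟩
  rw [mem_MIN_iff, mem_MIL_iff, consequenceMIN_iff_consequenceMIL]
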